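/- Work in second-order arithmetic with the base theory $\mathsf{RCA}_0$ (basic arithmetic, $\Sigma^0_1$ induction, $\Delta^0_1$ comprehension). Let $\mathcal P_{\mathrm f}(A)$ be the set of (codes of) finite subsets of $A$. For a quasi-order $Q$ let $\mathcal P_{\mathrm f}^\flat(Q)$ and $\mathcal P_{\mathrm f}^\sharp(Q)$ be $\mathcal P_{\mathrm f}(Q)$ with the quasi-orders $$A\le^\flat B \iff (\forall a\in A)(\exists b\in B)(a\le_Q b),\qquad A\le^\sharp B\iff (\forall b\in B)(\exists a\in A)(a\le_Q b).$$ A countable second-countable space consists of a set $X$, a sequence $(U_i)_{i\in I}$ of subsets of $X$ covering $X$, and a function $k:X\times I\times I\to I$ with $x\in U_{k(x,i,j)}\subseteq U_i\cap U_j$ whenever $x\in U_i\cap U_j$. For a quasi-order $P$, the space $\mathrm{upper}(P)$ has point set $P$, index set $I=\mathcal P_{\mathrm f}(P)$, basic open sets $U_i=\{x\in P: (\forall p\in i)\; x\not\le_P p\}$, and $k(x,i,j)=i\cup j$. A general second-countable space is given by a set $I$ and formulas "$X$ is a point", "$X$ and $Y$ are the same point", "the point $X$ lies in the basic open set $i\in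 I$", in which the points are sets, such that: every point lies in a basic open set; if a point lies in the basic open sets $i$ and $j$, then it lies in some basic open set $k$ such that every set satisfying the formula for $k$ satisfies those for $i$ and $j$; and membership in basic open sets respects sameness of points. The spaces $\mathrm{upper}(\mathcal P^\flat(Q))$ and $\mathrm{upper}(\mathcal P^\sharp(Q))$ have as points the subsets $X\subseteq Q$ (two points being the same if they are equal as sets) and index set $I=\mathcal P_{\mathrm f}(Q)$; the point $X$ lies in the basic open set $i$ if and only if $(\forall q\in i)(\exists p\in X)(q\le_Q p)$ in the case of $\flat$, and $(\forall q\in i)\neg(\exists p\in X)(p\le_Q q)$ in the case of $\sharp$. In either kind of space, a function $g:\mathbb N\times\mathbb N\to\mathcal P_{\mathrm f}(I)$ codes the sequence $(F_n)_{n\in\mathbb N}$ of effectively closed sets, where $F_n$ consists of the points that for no $m$ and no $i\in g(n,m)$ lie in the basic open set $i$. The space is Noetherian if for every such sequence with $F_n\supseteq F_{n+1}$ for all $n$ there is an $N$ with $F_n=F_N$ for all $n>N$. **Theorem.** $\mathsf{RCA}_0$ proves the following (equivalently, it holds in every model $(M,S)$ of $\mathsf{RCA}_0$, possibly with nonstandard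 first-order part $M$ and with set quantifiers ranging over $S\subseteq\mathcal P(M)$). Let $Q$ be a quasi-order. Then $\mathcal P_{\mathrm f}^\flat(Q)$ and $\mathcal P_{\mathrm f}^\sharp(Q)$ are quasi-orders, $\mathrm{upper}(\mathcal P_{\mathrm f}^\flat(Q))$ and $\mathrm{upper}(\mathcal P_{\mathrm f}^\sharp(Q))$ are countable second-countable spaces, $\mathrm{upper}(\mathcal P^\flat(Q))$ and $\mathrm{upper}(\mathcal P^\sharp(Q))$ are second-countable spaces, and 1. if $\mathrm{upper}(\mathcal P^\flat(Q))$ is Noetherian, then $\mathrm{upper}(\mathcal P_{\mathrm f}^\flat(Q))$ is Noetherian; 2. if $\mathrm{upper}(\mathcal P^\sharp(Q))$ is Noetherian, then $\mathrm{upper}(\mathcal P_{\mathrm f}^\sharp(Q))$ is Noetherian. -/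

import Mathlib

/-! Second-order arithmetic with Henkin semantics. A structure for the language of second-order
arithmetic consists of a number part `M` (with `0, 1, +, *, <`) and a collection `S` of subsets
of `M` over which the set quantifiers range. A statement is a theorem of a theory if and only if
it holds in every structure satisfying the axioms (Gödel completeness), so "provable in RCA₀" is
rendered by "true in every model `(M, S)` of RCA₀". In all definitions below, number quantifiers
range over `M` and set quantifiers range over `S`. -/

namespace SOA

universe u

/-- Number terms whose free number variables are indexed by `Fin n`. -/
inductive NumTerm (n : ℕ) : Type
  | var (i : Fin n) : NumTerm n
  | zero : NumTerm n
  | one : NumTerm n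
  | add (s t : NumTerm n) : NumTerm n
  | mul (s t : NumTerm n) : NumTerm n

/-- Bounded-quantifier formulas with free number variables indexed by `Fin n` and free set
variables indexed by `ℕ`. In `ball t φ`, i.e. `(∀ x < t) φ`, the bound variable is the variable
`0` of `φ`, and the variable `i` of `t` is the variable `i + 1` of `φ`. The other connectives and
the bounded existential quantifier are the usual classical abbreviations. -/
inductive BddFormula : ℕ → Type
  | eq {n : ℕ} (s t : NumTerm n) : BddFormula n
  | lt {n : ℕ} (s t : NumTerm n) : BddFormula n
  | mem {n : ℕ} (t : NumTerm n) (X : ℕ) : BddFormula n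
  | neg {n : ℕ} (φ : BddFormula n) : BddFormula n
  | and {n : ℕ} (φ ψ : BddFormula n) : BddFormula n
  | ball {n : ℕ} (t : NumTerm n) (φ : BddFormula (n + 1)) : BddFormula n

section Semantics

variable {M : Type u} [CommSemiring M] [LinearOrder M]

/-- The value of a term. -/
def NumTerm.eval {n : ℕ} (e : Fin n → M) : NumTerm n → M
  | .var i => e i
  | .zero => 0
  | .one => 1
  | .add s t => s.eval e + t.eval e
  | .mul s t => s.eval e * t.eval e

/-- Satisfaction of a bounded formula, under an assignment `E` of sets to the set variables
and `e` of numbers to the number variables. -/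
def BddFormula.Holds (E : ℕ → Set M) : {n : ℕ} → BddFormula n → (Fin n → M) → Prop
  | _, .eq s t, e => s.eval e = t.eval e
  | _, .lt s t, e => s.eval e < t.eval e
  | _, .mem t X, e => t.eval e ∈ E X
  | _, .neg φ, e => ¬ φ.Holds E e
  | _, .and φ ψ, e => φ.Holds E e ∧ ψ.Holds E e
  | _, .ball t φ, e => ∀ a : M, a < t.eval e → φ.Holds E (Matrix.vecCons a e)

/-- `(M, S)` is a model of RCA₀: `M` is a discretely ordered commutative semiring with identity
(with least element `0`), and `(M, S)` satisfies the `Σ⁰₁` induction scheme and the `Δ⁰₁`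
comprehension scheme. A `Σ⁰₁` (respectively `Π⁰₁`) formula is `∃ y θ` (respectively `∀ y θ`)
with `θ` a bounded formula; `e` and `E` are the number and set parameters. -/
structure ModelsRCA0 [IsStrictOrderedRing M] (S : Set (Set M)) : Prop where
  zero_le : ∀ x : M, 0 ≤ x
  discrete : ∀ x y : M, x < y + 1 ↔ x ≤ y
  sigma_induction : ∀ (n : ℕ) (θ : BddFormula (n + 2)) (E : ℕ → Set M) (e : Fin n → M),
    (∀ i, E i ∈ S) →
    (∃ y, θ.Holds E (Matrix.vecCons y (Matrix.vecCons 0 e))) →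
    (∀ x, (∃ y, θ.Holds E (Matrix.vecCons y (Matrix.vecCons x e))) →
      ∃ y, θ.Holds E (Matrix.vecCons y (Matrix.vecCons (x + 1) e))) →
    ∀ x, ∃ y, θ.Holds E (Matrix.vecCons y (Matrix.vecCons x e))
  delta_comprehension : ∀ (n : ℕ) (θ ψ : BddFormula (n + 2)) (E : ℕ → Set M) (e : Fin n → M),
    (∀ i, E i ∈ S) →
    (∀ x, (∃ y, θ.Holds E (Matrix.vecCons y (Matrix.vecCons x e))) ↔
      ∀ y, ψ.Holds E (Matrix.vecCons y (Matrix.vecCons x e))) →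
    {x : M | ∃ y, θ.Holds E (Matrix.vecCons y (Matrix.vecCons x e))} ∈ S

/-! ### Coding of pairs, finite sets and functions -/

/-- The pairing function of second-order arithmetic. -/
def pair (x y : M) : M := (x + y) * (x + y) + x

/-- The Cartesian product, as a set of codes of pairs. -/
def cprod (A B : Set M) : Set M := {z | ∃ a ∈ A, ∃ b ∈ B, z = pair a b}

/-- `F` is (the graph of) a function from `A` to `B`. -/
def IsFunction (F A B : Set M) : Prop :=
  F ⊆ cprod A B ∧ ∀ a ∈ A, ∃! b, pair a b ∈ F

/-- The number `i` is an element of the finite set described by the number `c = (k, (m, n))`,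
namely the set of all `i < k` such that `m (i + 1) + 1` divides `n`. -/
def FinMem (i c : M) : Prop :=
  ∃ k m n : M, c = pair k (pair m n) ∧ i < k ∧ (m * (i + 1) + 1) ∣ n

/-- `c` is the code of a finite set: the least number describing that set. -/
def IsFinCode (c : M) : Prop :=
  ∀ d < c, ∃ i, ¬ (FinMem i d ↔ FinMem i c)

/-- The set of (codes of) finite subsets of `A`. -/
def Pf (A : Set M) : Set M :=
  {c | IsFinCode c ∧ ∀ i, FinMem i c → i ∈ A}

end Semantics

/-! ### Quasi-orders -/

/-- A set with a binary relation on it, the relation being a set of codes of pairs. -/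
structure RelSet (M : Type u) where
  carrier : Set M
  rel : Set M

section Spaces

variable {M : Type u} [CommSemiring M] [LinearOrder M]

/-- The relation `x ≤_Q y`. -/
def RelSet.Le (Q : RelSet M) (x y : M) : Prop := pair x y ∈ Q.rel

/-- `Q` is a quasi-order in the sense of `(M, S)`. -/
structure IsQuasiOrder (S : Set (Set M)) (Q : RelSet M) : Prop where
  carrier_mem : Q.carrier ∈ S
  rel_mem : Q.rel ∈ S
  rel_subset : Q.rel ⊆ cprod Q.carrier Q.carrier
  refl : ∀ x ∈ Q.carrier, Q.Le x x
  trans : ∀ x ∈ Q.carrier, ∀ y ∈ Q.carrier, ∀ z ∈ Q.carrier, Q.Le x y → Q.Le y z → Q.Le x z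

/-- The quasi-order `P_f^♭(Q)` on the finite subsets of `Q`. -/
def PfFlat (Q : RelSet M) : RelSet M where
  carrier := Pf Q.carrier
  rel := {z | ∃ a ∈ Pf Q.carrier, ∃ b ∈ Pf Q.carrier, z = pair a b ∧
    ∀ x, FinMem x a → ∃ y, FinMem y b ∧ Q.Le x y}

/-- The quasi-order `P_f^♯(Q)` on the finite subsets of `Q`. -/
def PfSharp (Q : RelSet M) : RelSet M where
  carrier := Pf Q.carrier
  rel := {z | ∃ a ∈ Pf Q.carrier, ∃ b ∈ Pf Q.carrier, z = pair a b ∧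
    ∀ y, FinMem y b → ∃ x, FinMem x a ∧ Q.Le x y}

/-! ### Countable second-countable spaces -/

/-- The data of a countable second-countable space: a set `X` of points, a set `I` of indices,
a sequence `(U_i)_{i ∈ I}` of subsets of `X` coded by the set `U = {(x, i) : x ∈ U_i}`, and a
function `k : X × I × I → I`. -/
structure CSCSpace (M : Type u) where
  X : Set M
  I : Set M
  U : Set M
  k : Set M

/-- `x ∈ U_i`. -/
def CSCSpace.InBasic (T : CSCSpace M) (x i : M) : Prop := pair x i ∈ T.U

/-- The data `T` exist in `(M, S)` and form a countable second-countable space there. -/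
structure CSCSpace.IsSpace (S : Set (Set M)) (T : CSCSpace M) : Prop where
  X_mem : T.X ∈ S
  I_mem : T.I ∈ S
  U_mem : T.U ∈ S
  k_mem : T.k ∈ S
  U_subset : T.U ⊆ cprod T.X T.I
  k_function : IsFunction T.k (cprod T.X (cprod T.I T.I)) T.I
  cover : ∀ x ∈ T.X, ∃ i ∈ T.I, T.InBasic x i
  inter : ∀ x ∈ T.X, ∀ i ∈ T.I, ∀ j ∈ T.I, T.InBasic x i → T.InBasic x j →
    ∀ l, pair (pair x (pair i j)) l ∈ T.k →
      T.InBasic x l ∧ ∀ y ∈ T.X, T.InBasic y l → T.InBasic y i ∧ T.InBasic y j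

/-- For a code `g : ℕ × ℕ → P_f(I)` of a sequence `(F_n)` of effectively closed sets,
`x ∈ F_n`, i.e. `x ∈ X` and `x ∉ U_i` for all `m` and all `i ∈ g(n, m)`. -/
def CSCSpace.InClosed (T : CSCSpace M) (g : Set M) (n x : M) : Prop :=
  x ∈ T.X ∧ ∀ m c, pair (pair n m) c ∈ g → ∀ i, FinMem i c → ¬ T.InBasic x i

/-- Every descending sequence of effectively closed sets stabilizes. -/
def CSCSpace.IsNoetherian (S : Set (Set M)) (T : CSCSpace M) : Prop :=
  ∀ g ∈ S, IsFunction g (cprod Set.univ Set.univ) (Pf T.I) →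
    (∀ n x, T.InClosed g (n + 1) x → T.InClosed g n x) →
    ∃ N, ∀ n, N < n → ∀ x, T.InClosed g n x ↔ T.InClosed g N x

/-- The upper topology of a quasi-order: the points are the elements of `Q`, the indices are the
finite subsets `i` of `Q`, with `V_i = Q \ (i↓)`, and the function is `ℓ(q, i, j) = i ∪ j`. -/
def upper (Q : RelSet M) : CSCSpace M where
  X := Q.carrier
  I := Pf Q.carrier
  U := {z | ∃ x ∈ Q.carrier, ∃ i ∈ Pf Q.carrier, z = pair x i ∧
    ¬ ∃ p, FinMem p i ∧ Q.Le x p}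
  k := {z | ∃ x ∈ Q.carrier, ∃ i ∈ Pf Q.carrier, ∃ j ∈ Pf Q.carrier, ∃ l ∈ Pf Q.carrier,
    z = pair (pair x (pair i j)) l ∧ ∀ p, FinMem p l ↔ FinMem p i ∨ FinMem p j}

/-! ### General second-countable spaces -/

/-- The data of a general second-countable space: a set `I` of codes of open sets and formulas
"`X` codes a point", "`X` and `Y` code the same point", and "the point coded by `X` is in the
open set coded by `i`". -/
structure SCSpace (M : Type u) where
  I : Set M
  IsPoint : Set M → Prop
  Same : Set M → Set M → Prop
  InBasic : Set M → M → Prop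

/-- The data `T` code a second-countable space in `(M, S)`. -/
structure SCSpace.IsSpace (S : Set (Set M)) (T : SCSpace M) : Prop where
  I_mem : T.I ∈ S
  cover : ∀ X ∈ S, T.IsPoint X → ∃ i ∈ T.I, T.InBasic X i
  inter : ∀ X ∈ S, T.IsPoint X → ∀ i ∈ T.I, ∀ j ∈ T.I, T.InBasic X i → T.InBasic X j →
    ∃ k ∈ T.I, T.InBasic X k ∧ ∀ Y ∈ S, T.InBasic Y k → T.InBasic Y i ∧ T.InBasic Y j
  congr : ∀ X ∈ S, ∀ Y ∈ S, T.IsPoint X → T.IsPoint Y → ∀ i ∈ T.I, T.InBasic X i →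
    T.Same X Y → T.InBasic Y i

/-- For a code `g : ℕ × ℕ → P_f(I)` of a sequence `(F_n)` of effectively closed sets,
`X ∈ F_n`. -/
def SCSpace.InClosed (T : SCSpace M) (g : Set M) (n : M) (X : Set M) : Prop :=
  T.IsPoint X ∧ ∀ m c, pair (pair n m) c ∈ g → ∀ i, FinMem i c → ¬ T.InBasic X i

/-- Every descending sequence of effectively closed sets stabilizes. -/
def SCSpace.IsNoetherian (S : Set (Set M)) (T : SCSpace M) : Prop :=
  ∀ g ∈ S, IsFunction g (cprod Set.univ Set.univ) (Pf T.I) →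
    (∀ n, ∀ X ∈ S, T.InClosed g (n + 1) X → T.InClosed g n X) →
    ∃ N, ∀ n, N < n → ∀ X ∈ S, T.InClosed g n X ↔ T.InClosed g N X

/-- The second-countable space `upper(P^♭(Q))`: the points are the subsets of `Q`, and `X` is in
the open set coded by the finite set `i` if `i ⊆ X↓`. -/
def upperPFlat (Q : RelSet M) : SCSpace M where
  I := Pf Q.carrier
  IsPoint X := X ⊆ Q.carrier
  Same X Y := X = Y
  InBasic X i := ∀ q, FinMem q i → ∃ p ∈ X, Q.Le q p

/-- The second-countable space `upper(P^♯(Q))`: the points are the subsets of `Q`, and `X` is in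
the open set coded by the finite set `i` if `i ∩ X↑ = ∅`. -/
def upperPSharp (Q : RelSet M) : SCSpace M where
  I := Pf Q.carrier
  IsPoint X := X ⊆ Q.carrier
  Same X Y := X = Y
  InBasic X i := ∀ q, FinMem q i → ¬ ∃ p ∈ X, Q.Le p q

end Spaces

end SOA

/-! Send a finite set `a` to the set of its elements, viewed as a point of the space of all subsets.
Noetherianness pulls back along this map once every basic open set of the finite-subset space is the
preimage of a union of basic open sets given by a relation `R` that exists in `S`.

Flat case: `a` avoids the down-closure of `i` iff some finite `j` avoids it and satisfies `j ≤♭ a`;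
take `j = a` in one direction and use transitivity in the other. Sharp case: `a ≰♯ p` means that
some `b ∈ p` lies outside the upward closure of `a`. Hence `a` avoids the down-closure of `i` iff
some finite `j` meets every `p ∈ i` and is disjoint from that closure.

A descending sequence `F_n` of closed sets then has to be turned into a sequence on the larger space
that descends at all points, not only at finite ones. So stage `n` removes the open sets translated
from all `F_k` with `k ≤ n`. On finite points this recovers `F_n`, since `F_n ⊆ F_k`; that inclusion
uses `Σ⁰₁` induction on non-membership (`not_inClosed_add`). `isNoetherian_of_embedding` carries out
the transfer.

The remaining work takes place inside `RCA₀`: closing bounded predicates under the operations used,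
and showing with Gödel's β-function that every bounded set in `S` has a finite code
(`exists_finCode`). -/

namespace SOA

universe u

/-! ### Bounded predicates -/

/-- Renaming of number variables in a term. -/
def NumTerm.lift {n : ℕ} : NumTerm n → NumTerm (n + 1)
  | .var i => .var i.succ
  | .zero => .zero
  | .one => .one
  | .add s t => .add s.lift t.lift
  | .mul s t => .mul s.lift t.lift

/-- Renaming of set variables in a bounded formula. -/
def BddFormula.renameSet (f : ℕ → ℕ) : {n : ℕ} → BddFormula n → BddFormula n
  | _, .eq s t => .eq s t
  | _, .lt s t => .lt s t
  | _, .mem t X => .mem t (f X)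
  | _, .neg φ => .neg (φ.renameSet f)
  | _, .and φ ψ => .and (φ.renameSet f) (ψ.renameSet f)
  | _, .ball t φ => .ball t (φ.renameSet f)

section Definability

variable {M : Type u} [CommSemiring M] {S : Set (Set M)} {n : ℕ}

theorem NumTerm.eval_lift (t : NumTerm n) (v : Fin (n + 1) → M) :
    t.lift.eval v = t.eval fun i => v i.succ := by
  induction t with
  | var i => rfl
  | zero => rfl
  | one => rfl
  | add s t hs ht => simp [NumTerm.lift, NumTerm.eval, hs, ht]
  | mul s t hs ht => simp [NumTerm.lift, NumTerm.eval, hs, ht]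

/-- `f` is the value of a number term. -/
def IsTerm (f : (Fin n → M) → M) : Prop := ∃ t : NumTerm n, ∀ v, t.eval v = f v

namespace IsTerm

theorem var (i : Fin n) : IsTerm (fun v : Fin n → M => v i) := ⟨.var i, fun _ => rfl⟩

theorem zero : IsTerm (fun _ : Fin n → M => 0) := ⟨.zero, fun _ => rfl⟩

theorem one : IsTerm (fun _ : Fin n → M => 1) := ⟨.one, fun _ => rfl⟩

variable {f g : (Fin n → M) → M}

theorem add (hf : IsTerm f) (hg : IsTerm g) : IsTerm (fun v => f v + g v) := by
  obtain ⟨s, hs⟩ := hf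
  obtain ⟨t, ht⟩ := hg
  exact ⟨.add s t, fun v => by simp [NumTerm.eval, hs, ht]⟩

theorem mul (hf : IsTerm f) (hg : IsTerm g) : IsTerm (fun v => f v * g v) := by
  obtain ⟨s, hs⟩ := hf
  obtain ⟨t, ht⟩ := hg
  exact ⟨.mul s t, fun v => by simp [NumTerm.eval, hs, ht]⟩

theorem pair (hf : IsTerm f) (hg : IsTerm g) : IsTerm (fun v => SOA.pair (f v) (g v)) :=
  ((hf.add hg).mul (hf.add hg)).add hf

theorem lift (hf : IsTerm f) : IsTerm (fun v : Fin (n + 1) → M => f fun i => v i.succ) := by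
  obtain ⟨s, hs⟩ := hf
  exact ⟨s.lift, fun v => by rw [NumTerm.eval_lift, hs]⟩

end IsTerm

variable [LinearOrder M]

theorem BddFormula.holds_renameSet (f : ℕ → ℕ) (E : ℕ → Set M) (φ : BddFormula n)
    (e : Fin n → M) : (φ.renameSet f).Holds E e ↔ φ.Holds (fun i => E (f i)) e := by
  induction φ with
  | eq s t => rfl
  | lt s t => rfl
  | mem t X => rfl
  | neg φ h => simp [BddFormula.renameSet, BddFormula.Holds, h]
  | and φ ψ h h' => simp [BddFormula.renameSet, BddFormula.Holds, h, h']
  | ball t φ h => simp [BddFormula.renameSet, BddFormula.Holds, h]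

/-- `P` is defined by a bounded formula with set parameters from `S`. -/
def IsBdd (S : Set (Set M)) (P : (Fin n → M) → Prop) : Prop :=
  ∃ (φ : BddFormula n) (E : ℕ → S), ∀ v, φ.Holds (fun i => (E i : Set M)) v ↔ P v

namespace IsBdd

variable {f g : (Fin n → M) → M} {P R : (Fin n → M) → Prop}

theorem congr (hP : IsBdd S P) (h : ∀ v, P v ↔ R v) : IsBdd S R := by
  obtain ⟨φ, E, hφ⟩ := hP
  exact ⟨φ, E, fun v => (hφ v).trans (h v)⟩

theorem eq [Nonempty S] (hf : IsTerm f) (hg : IsTerm g) : IsBdd S (fun v => f v = g v) := by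
  obtain ⟨s, hs⟩ := hf
  obtain ⟨t, ht⟩ := hg
  exact ⟨.eq s t, fun _ => Classical.arbitrary S, fun v => by simp [BddFormula.Holds, hs, ht]⟩

theorem lt [Nonempty S] (hf : IsTerm f) (hg : IsTerm g) : IsBdd S (fun v => f v < g v) := by
  obtain ⟨s, hs⟩ := hf
  obtain ⟨t, ht⟩ := hg
  exact ⟨.lt s t, fun _ => Classical.arbitrary S, fun v => by simp [BddFormula.Holds, hs, ht]⟩

theorem mem {A : Set M} (hA : A ∈ S) (hf : IsTerm f) : IsBdd S (fun v => f v ∈ A) := by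
  obtain ⟨s, hs⟩ := hf
  exact ⟨.mem s 0, fun _ => ⟨A, hA⟩, fun v => by simp [BddFormula.Holds, hs]⟩

theorem not (hP : IsBdd S P) : IsBdd S (fun v => ¬ P v) := by
  obtain ⟨φ, E, hφ⟩ := hP
  exact ⟨.neg φ, E, fun v => not_congr (hφ v)⟩

theorem and (hP : IsBdd S P) (hR : IsBdd S R) : IsBdd S (fun v => P v ∧ R v) := by
  obtain ⟨φ, E, hφ⟩ := hP
  obtain ⟨ψ, F, hψ⟩ := hR
  -- The two parameter sequences are interleaved: `φ` reads the even set variables and `ψ` the odd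
  -- ones.
  refine ⟨.and (φ.renameSet fun i => 2 * i) (ψ.renameSet fun i => 2 * i + 1),
    fun i => if i % 2 = 0 then E (i / 2) else F (i / 2), fun v => and_congr ?_ ?_⟩
  · rw [BddFormula.holds_renameSet, ← hφ]
    simp
  · rw [BddFormula.holds_renameSet, ← hψ]
    have h (i : ℕ) : (2 * i + 1) / 2 = i := by omega
    simp [Nat.add_mod, h]

theorem or (hP : IsBdd S P) (hR : IsBdd S R) : IsBdd S (fun v => P v ∨ R v) :=
  (hP.not.and hR.not).not.congr fun v => by tauto

theorem imp (hP : IsBdd S P) (hR : IsBdd S R) : IsBdd S (fun v => P v → R v) :=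
  (hP.not.or hR).congr fun v => by tauto

theorem iff (hP : IsBdd S P) (hR : IsBdd S R) : IsBdd S (fun v => P v ↔ R v) :=
  ((hP.imp hR).and (hR.imp hP)).congr fun v => by tauto

theorem ball {P : M → (Fin n → M) → Prop} (hf : IsTerm f)
    (hP : IsBdd S fun v : Fin (n + 1) → M => P (v 0) fun i => v i.succ) :
    IsBdd S (fun v => ∀ a, a < f v → P a v) := by
  obtain ⟨s, hs⟩ := hf
  obtain ⟨φ, E, hφ⟩ := hP
  refine ⟨.ball s φ, E, fun v => ?_⟩
  simp only [BddFormula.Holds, hs]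
  exact forall₂_congr fun a _ => hφ _

theorem bex {P : M → (Fin n → M) → Prop} (hf : IsTerm f)
    (hP : IsBdd S fun v : Fin (n + 1) → M => P (v 0) fun i => v i.succ) :
    IsBdd S (fun v => ∃ a, a < f v ∧ P a v) :=
  (ball (P := fun a v => ¬ P a v) hf hP.not).not.congr fun v => by push Not; rfl

end IsBdd

end Definability

/-! ### Elementary arithmetic in models of `RCA₀` -/

section Models

variable {M : Type u} [CommSemiring M] [LinearOrder M] [IsStrictOrderedRing M] {S : Set (Set M)}

namespace ModelsRCA0

section Schemes

variable (hM : ModelsRCA0 S)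
include hM

/-- A bounded formula is both `Σ⁰₁` and `Π⁰₁` through a dummy quantifier. That dummy is variable
`0`, so in applications `w 0` appears as `.var 1`. -/
theorem comprehension {n : ℕ} {P : (Fin (n + 1) → M) → Prop}
    (hP : IsBdd S fun v : Fin (n + 2) → M => P fun i => v i.succ) (e : Fin n → M) :
    {x | P (Matrix.vecCons x e)} ∈ S := by
  obtain ⟨φ, E, hφ⟩ := hP
  have h (x y : M) : φ.Holds (fun i => (E i : Set M)) (Matrix.vecCons y (Matrix.vecCons x e)) ↔
      P (Matrix.vecCons x e) := hφ _
  have := hM.delta_comprehension n φ φ (fun i => E i) e (fun i => (E i).2) fun x => by simp [h]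
  simpa [h] using this

theorem sigma_ind {n : ℕ} {P : M → (Fin (n + 1) → M) → Prop}
    (hP : IsBdd S fun v : Fin (n + 2) → M => P (v 0) fun i => v i.succ) (e : Fin n → M)
    (zero : ∃ y, P y (Matrix.vecCons 0 e))
    (succ : ∀ x, (∃ y, P y (Matrix.vecCons x e)) → ∃ y, P y (Matrix.vecCons (x + 1) e)) (x : M) :
    ∃ y, P y (Matrix.vecCons x e) := by
  obtain ⟨φ, E, hφ⟩ := hP
  have h (x y : M) : φ.Holds (fun i => (E i : Set M)) (Matrix.vecCons y (Matrix.vecCons x e)) ↔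
      P y (Matrix.vecCons x e) := hφ _
  have := hM.sigma_induction n φ (fun i => E i) e (fun i => (E i).2)
  simp only [h] at this
  exact this zero succ x

/-! ### Discrete order and the pairing function -/

theorem add_one_le {x y : M} : x + 1 ≤ y ↔ x < y := by
  rw [← not_lt, hM.discrete, not_le]

theorem pos_iff {x : M} : 0 < x ↔ x ≠ 0 :=
  ⟨fun h => h.ne', fun h => lt_of_le_of_ne (hM.zero_le x) h.symm⟩

theorem one_le {x : M} (h : x ≠ 0) : 1 ≤ x := by
  simpa using hM.add_one_le.2 (hM.pos_iff.2 h)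

theorem le_add_right (x y : M) : x ≤ x + y := le_add_of_nonneg_right (hM.zero_le y)

theorem le_add_left (x y : M) : y ≤ x + y := le_add_of_nonneg_left (hM.zero_le x)

theorem le_mul_right (x : M) {y : M} (h : y ≠ 0) : x ≤ x * y :=
  le_mul_of_one_le_right (hM.zero_le x) (hM.one_le h)

theorem add_le_pair (x y : M) : x + y ≤ pair x y := by
  refine le_trans ?_ (hM.le_add_right _ _)
  by_cases h : x + y = 0
  · simp [h]
  · exact hM.le_mul_right _ h

theorem left_le_pair (x y : M) : x ≤ pair x y :=
  (hM.le_add_right x y).trans (hM.add_le_pair x y)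

theorem right_le_pair (x y : M) : y ≤ pair x y :=
  (hM.le_add_left x y).trans (hM.add_le_pair x y)

/-- With `s = x + y`, the code `s² + x` lies in the interval `[s², (s + 1)²)`, and these intervals
are disjoint for different `s`. -/
theorem add_le_add_of_pair {x y x' y' : M} (h : pair x y = pair x' y') : x' + y' ≤ x + y := by
  by_contra! hlt
  have h1 : (x + y + 1) * (x + y + 1) ≤ (x' + y') * (x' + y') :=
    mul_self_le_mul_self (hM.zero_le _) (hM.add_one_le.2 hlt)
  have h2 : (x + y) * (x + y) + x < (x + y + 1) * (x + y + 1) := by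
    calc (x + y) * (x + y) + x ≤ (x + y) * (x + y) + (x + y) := by
          gcongr
          exact hM.le_add_right _ _
      _ ≤ (x + y) * (x + y) + (x + y) + (x + y) := hM.le_add_right _ _
      _ < (x + y) * (x + y) + (x + y) + (x + y) + 1 := lt_add_one _
      _ = (x + y + 1) * (x + y + 1) := by ring
  have h3 : pair x' y' < pair x' y' := by
    calc pair x' y' = (x + y) * (x + y) + x := h.symm
      _ < _ := h2
      _ ≤ _ := h1
      _ ≤ pair x' y' := hM.le_add_right _ _
  exact lt_irrefl _ h3

theorem pair_inj {x y x' y' : M} : pair x y = pair x' y' ↔ x = x' ∧ y = y' := by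
  refine ⟨fun h => ?_, fun h => by rw [h.1, h.2]⟩
  have hs : x + y = x' + y' :=
    le_antisymm (hM.add_le_add_of_pair h.symm) (hM.add_le_add_of_pair h)
  unfold pair at h
  rw [hs] at h
  have hx := add_left_cancel h
  exact ⟨hx, add_left_cancel (hx ▸ hs)⟩

theorem pair_mem_cprod {A B : Set M} {x y : M} : pair x y ∈ cprod A B ↔ x ∈ A ∧ y ∈ B := by
  constructor
  · rintro ⟨a, ha, b, hb, h⟩
    obtain ⟨rfl, rfl⟩ := hM.pair_inj.1 h
    exact ⟨ha, hb⟩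
  · rintro ⟨ha, hb⟩
    exact ⟨x, ha, y, hb, rfl⟩

theorem induction {A : Set M} (hA : A ∈ S) (zero : 0 ∈ A) (succ : ∀ x ∈ A, x + 1 ∈ A) (x : M) :
    x ∈ A := by
  have := hM.sigma_ind (P := fun _ w => w 0 ∈ A) (IsBdd.mem hA (.var 1)) ![]
  simp only [Matrix.cons_val_zero, exists_const] at this
  exact this zero succ x

/-- Otherwise induction shows that no element of `A` lies below `y`, for every `y`; the case `y = x
+ 1` is absurd. -/
theorem exists_least {A : Set M} (hA : A ∈ S) {x : M} (hx : x ∈ A) :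
    ∃ y ∈ A, y ≤ x ∧ ∀ z < y, z ∉ A := by
  by_contra! h
  have hB : {y | ∀ z, z < y → z ∉ A} ∈ S :=
    hM.comprehension (P := fun w => ∀ z, z < w 0 → z ∉ A)
      (IsBdd.ball (.var 1) (IsBdd.mem hA (.var 0)).not) ![]
  have hall := hM.induction hB (fun z hz => absurd hz (hM.zero_le z).not_gt) fun y hy z hz hzA => by
    rcases ((hM.discrete _ _).1 hz).lt_or_eq with hz | rfl
    · exact hy z hz hzA
    · by_cases hzx : z ≤ x
      · obtain ⟨t, ht, htA⟩ := h z hzA hzx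
        exact hy t ht htA
      · exact hy x (not_le.1 hzx) hx
  exact hall (x + 1) x (lt_add_one x) hx

variable [Nonempty S]

/-- Subtraction is not among the axioms; it comes from `Σ⁰₁` induction on `y`, the disjunct `y < x`
covering the values before `x` is reached. -/
theorem exists_add {x y : M} (h : x ≤ y) : ∃ z, y = x + z := by
  have := hM.sigma_ind (P := fun z w => w 0 = w 1 + z ∨ w 0 < w 1)
    ((IsBdd.eq (.var 1) (.add (.var 2) (.var 0))).or (IsBdd.lt (.var 1) (.var 2))) ![x]
    ?_ ?_ y
  · obtain ⟨z, hz | hz⟩ := this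
    · exact ⟨z, hz⟩
    · exact absurd hz h.not_gt
  · refine ⟨0, ?_⟩
    simpa [eq_comm] using (hM.zero_le x).eq_or_lt
  · rintro y ⟨z, hz | hz⟩
    · exact ⟨z + 1, .inl (by simpa [← add_assoc] using hz)⟩
    · refine ⟨0, ?_⟩
      simpa using (hM.add_one_le.2 hz).eq_or_lt

theorem dvd_of_dvd_add {p a b : M} (hp : p ≠ 0) (ha : p ∣ a) (hab : p ∣ a + b) : p ∣ b := by
  obtain ⟨u, rfl⟩ := ha
  obtain ⟨w, hw⟩ := hab
  have huw : u ≤ w := by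
    refine le_of_mul_le_mul_left ?_ (hM.pos_iff.2 hp)
    rw [← hw]
    exact hM.le_add_right _ _
  obtain ⟨z, rfl⟩ := hM.exists_add huw
  rw [mul_add] at hw
  exact ⟨z, add_left_cancel hw⟩

omit [Nonempty S] in
theorem le_of_dvd {a b : M} (hb : b ≠ 0) (h : a ∣ b) : a ≤ b := by
  obtain ⟨c, rfl⟩ := h
  exact hM.le_mul_right _ (right_ne_zero_of_mul hb)

end Schemes

end ModelsRCA0

/-! ### Definability of divisibility, pairs and finite sets -/

namespace IsBdd

variable {n : ℕ} {f g : (Fin n → M) → M}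

variable [Nonempty S] (hM : ModelsRCA0 S)
include hM

theorem dvd (hf : IsTerm f) (hg : IsTerm g) : IsBdd S (fun v => f v ∣ g v) := by
  refine (bex (f := fun v => g v + 1) (P := fun q v => g v = f v * q) (hg.add .one)
    (eq hg.lift (hf.lift.mul (.var 0)))).congr fun v => ?_
  constructor
  · rintro ⟨q, -, h⟩
    exact ⟨q, h⟩
  · rintro ⟨q, h⟩
    -- A quotient is at most the dividend unless the dividend is `0`, where the given quotient may
    -- be large and is replaced by `0`.
    by_cases hg : g v = 0
    · exact ⟨0, by simp [hg]⟩
    · exact ⟨q, (hM.discrete _ _).2 (hM.le_of_dvd hg ⟨f v, by rw [h, mul_comm]⟩), h⟩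

theorem exists_pair {P : M → M → (Fin n → M) → Prop} (hf : IsTerm f)
    (hP : IsBdd S fun v : Fin (n + 2) → M => P (v 1) (v 0) fun i => v i.succ.succ) :
    IsBdd S (fun v => ∃ a b, f v = pair a b ∧ P a b v) := by
  refine (bex (f := fun v => f v + 1) (P := fun a v => ∃ b, b < f v + 1 ∧ (f v = pair a b ∧ P a b v))
    (hf.add .one) (bex (f := fun v => f (fun i => v i.succ) + 1)
      (P := fun b v => f (fun i => v i.succ) = pair (v 0) b ∧ P (v 0) b fun i => v i.succ)
      (hf.lift.add .one) ((eq hf.lift.lift (.pair (.var 1) (.var 0))).and hP))).congr fun v => ?_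
  constructor
  · rintro ⟨a, -, b, -, h⟩
    exact ⟨a, b, h⟩
  · rintro ⟨a, b, h, hP⟩
    rw [h]
    exact ⟨a, (hM.discrete _ _).2 (hM.left_le_pair a b), b,
      (hM.discrete _ _).2 (hM.right_le_pair a b), rfl, hP⟩

theorem finMem (hf : IsTerm f) (hg : IsTerm g) : IsBdd S (fun v => FinMem (f v) (g v)) := by
  refine (exists_pair hM (P := fun k c v => ∃ m n, c = pair m n ∧
    (f v < k ∧ (m * (f v + 1) + 1) ∣ n)) hg
    (exists_pair hM (f := fun v => v 0) (P := fun m n v => f (fun i => v i.succ.succ) < v 1 ∧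
      (m * (f (fun i => v i.succ.succ) + 1) + 1) ∣ n) (.var 0)
      ((lt hf.lift.lift.lift.lift (.var 3)).and
        (dvd hM (((IsTerm.var 1).mul (hf.lift.lift.lift.lift.add .one)).add .one)
          (.var 0))))).congr fun v => ?_
  constructor
  · rintro ⟨k, _, h, m, n, rfl, h'⟩
    exact ⟨k, m, n, h, h'⟩
  · rintro ⟨k, m, n, h, h'⟩
    exact ⟨k, _, h, m, n, rfl, h'⟩

end IsBdd

namespace ModelsRCA0

variable (hM : ModelsRCA0 S)
include hM

theorem lt_of_finMem {i c : M} (h : FinMem i c) : i < c := by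
  obtain ⟨k, m, n, rfl, hi, -⟩ := h
  exact hi.trans_le (hM.left_le_pair _ _)

theorem not_finMem_zero (i : M) : ¬ FinMem i 0 := fun h =>
  (hM.lt_of_finMem h).not_ge (hM.zero_le i)

end ModelsRCA0

namespace IsBdd

variable {n : ℕ} {f g : (Fin n → M) → M} [Nonempty S] (hM : ModelsRCA0 S)
include hM

theorem exists_finMem {P : M → (Fin n → M) → Prop} (hf : IsTerm f)
    (hP : IsBdd S fun v : Fin (n + 1) → M => P (v 0) fun i => v i.succ) :
    IsBdd S (fun v => ∃ a, FinMem a (f v) ∧ P a v) :=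
  (bex (P := fun a v => FinMem a (f v) ∧ P a v) hf
    ((finMem hM (.var 0) hf.lift).and hP)).congr fun _ =>
    ⟨fun ⟨a, _, h⟩ => ⟨a, h⟩, fun ⟨a, h⟩ => ⟨a, hM.lt_of_finMem h.1, h⟩⟩

theorem forall_finMem {P : M → (Fin n → M) → Prop} (hf : IsTerm f)
    (hP : IsBdd S fun v : Fin (n + 1) → M => P (v 0) fun i => v i.succ) :
    IsBdd S (fun v => ∀ a, FinMem a (f v) → P a v) :=
  (exists_finMem hM (P := fun a v => ¬ P a v) hf hP.not).not.congr fun v => by push Not; rfl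

theorem isFinCode (hf : IsTerm f) : IsBdd S (fun v => IsFinCode (f v)) := by
  refine (ball (P := fun d v => ∃ i, i < f v ∧ ¬ (FinMem i d ↔ FinMem i (f v))) hf
    (bex (f := fun v => f fun i => v i.succ)
      (P := fun i v => ¬ (FinMem i (v 0) ↔ FinMem i (f fun i => v i.succ))) hf.lift
      ((finMem hM (.var 0) (.var 1)).iff (finMem hM (.var 0) hf.lift.lift)).not)).congr
    fun v => forall₂_congr fun d hd => ?_
  constructor
  · rintro ⟨i, -, h⟩
    exact ⟨i, h⟩
  · rintro ⟨i, h⟩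
    -- Elements lie below their code and `d < f v`, so any separating `i` is below `f v`.
    refine ⟨i, ?_, h⟩
    by_contra! hi
    exact h ⟨fun h' => absurd (hM.lt_of_finMem h') (hd.le.trans hi).not_gt,
      fun h' => absurd (hM.lt_of_finMem h') hi.not_gt⟩

theorem mem_Pf {A : Set M} (hA : A ∈ S) (hf : IsTerm f) : IsBdd S (fun v => f v ∈ Pf A) :=
  (isFinCode hM hf).and (forall_finMem hM (P := fun i _ => i ∈ A) hf (mem hA (.var 0)))

end IsBdd

/-! ### Coding of bounded sets -/

namespace ModelsRCA0

variable (hM : ModelsRCA0 S)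
include hM

theorem Pf_mem [Nonempty S] {A : Set M} (hA : A ∈ S) : Pf A ∈ S :=
  hM.comprehension (P := fun w => w 0 ∈ Pf A) (IsBdd.mem_Pf hM hA (.var 1)) ![]

omit hM [IsStrictOrderedRing M] in
theorem finCode_ext {c d : M} (hc : IsFinCode c) (hd : IsFinCode d)
    (h : ∀ i, FinMem i c ↔ FinMem i d) : c = d := by
  rcases lt_trichotomy c d with hlt | heq | hlt
  · obtain ⟨i, hi⟩ := hd c hlt
    exact absurd (h i) hi
  · exact heq
  · obtain ⟨i, hi⟩ := hc d hlt
    exact absurd (h i).symm hi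

theorem exists_common_multiple [Nonempty S] (b : M) :
    ∃ m, m ≠ 0 ∧ ∀ j, j < b → (j + 1) ∣ m := by
  refine hM.sigma_ind (P := fun m w => m ≠ 0 ∧ ∀ j, j < w 0 → (j + 1) ∣ m)
    ((IsBdd.eq (.var 0) .zero).not.and (IsBdd.ball (f := fun v => v 1)
      (P := fun j v => (j + 1) ∣ v 0) (.var 1)
      (IsBdd.dvd hM ((IsTerm.var 0).add .one) (.var 1)))) ![] ?_ ?_ b
  · exact ⟨1, one_ne_zero, fun j hj => absurd hj (hM.zero_le j).not_gt⟩
  · rintro x ⟨m, hm, h⟩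
    refine ⟨m * (x + 1), (mul_pos (hM.pos_iff.2 hm)
      ((hM.zero_le x).trans_lt (lt_add_one x))).ne', fun j hj => ?_⟩
    rcases ((hM.discrete _ _).1 hj).lt_or_eq with hj | rfl
    · exact (h j hj).mul_right _
    · exact Dvd.intro_left _ rfl

/-- Write `p_i = m(i+1) + 1`. Since `(j+1)p_i - (i+1)p_j = j - i`, `p_i` divides `n·|i - j|`. As `|i
- j|` divides `m`, `p_i` divides `n·m·(i+1) = n·p_i - n`, hence `n`. Everything is phrased
additively, without negative numbers. -/
theorem dvd_of_dvd_mul_of_lt [Nonempty S] {b m i j n : M} (hm : ∀ j, j < b → (j + 1) ∣ m)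
    (hi : i < b) (hj : j < b) (hij : i ≠ j) (h : (m * (i + 1) + 1) ∣ n * (m * (j + 1) + 1)) :
    (m * (i + 1) + 1) ∣ n := by
  have hp : m * (i + 1) + 1 ≠ 0 :=
    hM.pos_iff.1 ((hM.zero_le _).trans_lt (lt_add_one _))
  have key : ∃ d, d ∣ m ∧ (m * (i + 1) + 1) ∣ n * d := by
    rcases lt_or_gt_of_ne hij with hlt | hlt
    · obtain ⟨z, hz⟩ := hM.exists_add (hM.add_one_le.2 hlt)
      refine ⟨z + 1, hm z ((hM.le_add_left _ _).trans_lt (hz ▸ hj)), ?_⟩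
      refine hM.dvd_of_dvd_add (a := n * (i + 1) * (m * (j + 1) + 1)) hp ?_ ?_
      · rw [mul_right_comm]
        exact h.mul_right _
      · refine ⟨n * (j + 1), ?_⟩
        rw [hz]
        ring
    · obtain ⟨z, hz⟩ := hM.exists_add (hM.add_one_le.2 hlt)
      refine ⟨z + 1, hm z ((hM.le_add_left _ _).trans_lt (hz ▸ hi)), ?_⟩
      refine hM.dvd_of_dvd_add (a := n * (j + 1) * (m * (i + 1) + 1)) hp
        (Dvd.intro_left _ rfl) ?_
      refine (h.mul_right (i + 1)).trans (dvd_of_eq ?_)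
      rw [hz]
      ring
  obtain ⟨d, ⟨e, rfl⟩, hd⟩ := key
  refine hM.dvd_of_dvd_add (a := n * d * (e * (i + 1))) hp (hd.mul_right _) ⟨n, ?_⟩
  ring

/-- The β-function: `n` is built as the product of the moduli `m(i+1) + 1` for `i < b` in `A`, which
are pairwise coprime when `m` is a multiple of `1, …, b`. -/
theorem exists_finMem_iff [Nonempty S] {A : Set M} (hA : A ∈ S) (b : M) :
    ∃ c, ∀ i, FinMem i c ↔ i < b ∧ i ∈ A := by
  obtain ⟨m, hm0, hm⟩ := hM.exists_common_multiple b
  have := hM.sigma_ind (P := fun n w => ∀ i, i < w 1 →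
      ((w 2 * (i + 1) + 1) ∣ n ↔ i < w 0 ∧ i ∈ A))
    (IsBdd.ball (f := fun v => v 2) (P := fun i v => ((v 3 * (i + 1) + 1) ∣ v 0 ↔ i < v 1 ∧ i ∈ A))
      (.var 2) ((IsBdd.dvd hM (((IsTerm.var 4).mul ((IsTerm.var 0).add .one)).add .one)
        (.var 1)).iff ((IsBdd.lt (.var 0) (.var 2)).and (IsBdd.mem hA (.var 0))))) ![b, m] ?_ ?_ b
  · obtain ⟨n, hn⟩ := this
    change ∀ i, i < b → ((m * (i + 1) + 1) ∣ n ↔ i < b ∧ i ∈ A) at hn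
    refine ⟨pair b (pair m n), fun i => ⟨?_, fun hi => ⟨b, m, n, rfl, hi.1, (hn i hi.1).2 hi⟩⟩⟩
    rintro ⟨b', m', n', h, hi, hd⟩
    obtain ⟨hb, h⟩ := hM.pair_inj.1 h
    obtain ⟨rfl, rfl⟩ := hM.pair_inj.1 h
    rw [← hb] at hi
    exact (hn i hi).1 hd
  -- The empty product; `m ≠ 0` makes every modulus exceed `1`, so none divides it.
  · refine ⟨1, fun i _ => ⟨fun h => ?_, fun h => absurd h.1 (hM.zero_le i).not_gt⟩⟩
    have h1 : m * (i + 1) + 1 ≤ 1 := hM.le_of_dvd one_ne_zero h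
    have h2 : 0 < m * (i + 1) := mul_pos (hM.pos_iff.2 hm0)
      ((hM.zero_le i).trans_lt (lt_add_one i))
    exact absurd h1 (lt_add_of_pos_left 1 h2).not_ge
  · rintro x ⟨n, hn⟩
    change ∀ i, i < b → ((m * (i + 1) + 1) ∣ n ↔ i < x ∧ i ∈ A) at hn
    change ∃ n, ∀ i, i < b → ((m * (i + 1) + 1) ∣ n ↔ i < x + 1 ∧ i ∈ A)
    by_cases hx : x ∈ A ∧ x < b
    · refine ⟨n * (m * (x + 1) + 1), fun i hi => ?_⟩
      rw [hM.discrete, le_iff_lt_or_eq]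
      by_cases hix : i = x
      · subst hix
        exact ⟨fun _ => ⟨.inr rfl, hx.1⟩, fun _ => Dvd.intro_left _ rfl⟩
      · simp only [hix, or_false]
        rw [← hn i hi]
        exact ⟨hM.dvd_of_dvd_mul_of_lt hm hi hx.2 hix, fun h => h.mul_right _⟩
    · refine ⟨n, fun i hi => (hn i hi).trans ?_⟩
      rw [hM.discrete, le_iff_lt_or_eq]
      refine ⟨fun h => ⟨.inl h.1, h.2⟩, ?_⟩
      rintro ⟨h | rfl, hA⟩
      · exact ⟨h, hA⟩
      · exact absurd ⟨hA, hi⟩ hx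

/-- Every bounded set of the model is coded by a number. -/
theorem exists_finCode [Nonempty S] {A : Set M} (hA : A ∈ S) {b : M} (hb : ∀ i ∈ A, i < b) :
    ∃ c, IsFinCode c ∧ ∀ i, FinMem i c ↔ i ∈ A := by
  obtain ⟨c, hc⟩ := hM.exists_finMem_iff hA b
  -- The bound `d + c` exceeds all elements of both sets, so agreement becomes a bounded condition
  -- and a least code can be chosen.
  have hB : {d | ∀ i, i < d + c → (FinMem i d ↔ FinMem i c)} ∈ S :=
    hM.comprehension (P := fun w => ∀ i, i < w 0 + w 1 → (FinMem i (w 0) ↔ FinMem i (w 1)))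
      (IsBdd.ball (f := fun v => v 1 + v 2) (P := fun i v => FinMem i (v 1) ↔ FinMem i (v 2))
        ((IsTerm.var 1).add (.var 2))
        ((IsBdd.finMem hM (.var 0) (.var 2)).iff (IsBdd.finMem hM (.var 0) (.var 3)))) ![c]
  obtain ⟨d, hd, -, hmin⟩ := hM.exists_least hB (x := c) fun _ _ => Iff.rfl
  have hdc (i : M) : FinMem i d ↔ FinMem i c := by
    by_cases hi : i < d + c
    · exact hd i hi
    · exact ⟨fun h => absurd ((hM.lt_of_finMem h).trans_le (hM.le_add_right _ _)) hi,
        fun h => absurd ((hM.lt_of_finMem h).trans_le (hM.le_add_left _ _)) hi⟩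
  refine ⟨d, fun d' hd' => ?_, fun i => ?_⟩
  · by_contra! h
    exact hmin d' hd' fun i _ => (h i).trans (hdc i)
  · rw [hdc, hc]
    exact ⟨fun h => h.2, fun h => ⟨hb i h, h⟩⟩

theorem zero_mem_Pf (A : Set M) : (0 : M) ∈ Pf A :=
  ⟨fun d hd => absurd hd (hM.zero_le d).not_gt, fun i hi => absurd hi (hM.not_finMem_zero i)⟩

theorem finMem_set_mem [Nonempty S] (c : M) : {i | FinMem i c} ∈ S :=
  hM.comprehension (P := fun w => FinMem (w 0) (w 1)) (IsBdd.finMem hM (.var 1) (.var 2)) ![c]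

theorem exists_union [Nonempty S] {A : Set M} {i j : M} (hi : i ∈ Pf A) (hj : j ∈ Pf A) :
    ∃ l ∈ Pf A, ∀ p, FinMem p l ↔ FinMem p i ∨ FinMem p j := by
  have hU : {p | FinMem p i ∨ FinMem p j} ∈ S :=
    hM.comprehension (P := fun w => FinMem (w 0) (w 1) ∨ FinMem (w 0) (w 2))
      ((IsBdd.finMem hM (.var 1) (.var 2)).or (IsBdd.finMem hM (.var 1) (.var 3))) ![i, j]
  obtain ⟨l, hl, h⟩ := hM.exists_finCode hU (b := i + j) fun p hp => hp.elim
    (fun h => (hM.lt_of_finMem h).trans_le (hM.le_add_right _ _))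
    (fun h => (hM.lt_of_finMem h).trans_le (hM.le_add_left _ _))
  exact ⟨l, ⟨hl, fun p hp => ((h p).1 hp).elim (hi.2 p) (hj.2 p)⟩, h⟩

end ModelsRCA0
end Models

/-! ### Spaces -/

section Transfer

variable {M : Type u} [CommSemiring M] [LinearOrder M] [IsStrictOrderedRing M] {S : Set (Set M)}

omit [LinearOrder M] [IsStrictOrderedRing M] in
theorem IsQuasiOrder.nonempty {Q : RelSet M} (hQ : IsQuasiOrder S Q) : Nonempty S :=
  ⟨⟨_, hQ.carrier_mem⟩⟩

theorem IsQuasiOrder.mem_of_le (hM : ModelsRCA0 S) {Q : RelSet M} (hQ : IsQuasiOrder S Q) {x y : M}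
    (h : Q.Le x y) : x ∈ Q.carrier ∧ y ∈ Q.carrier :=
  hM.pair_mem_cprod.1 (hQ.rel_subset h)

/-! ### The upper space of a quasi-order -/

namespace ModelsRCA0

variable (hM : ModelsRCA0 S)
include hM

theorem inBasic_upper {P : RelSet M} {x i : M} : (upper P).InBasic x i ↔
    x ∈ P.carrier ∧ i ∈ Pf P.carrier ∧ ∀ p, FinMem p i → ¬ P.Le x p := by
  constructor
  · rintro ⟨x', hx, i', hi, h, hU⟩
    obtain ⟨rfl, rfl⟩ := hM.pair_inj.1 h
    exact ⟨hx, hi, fun p hp hle => hU ⟨p, hp, hle⟩⟩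
  · rintro ⟨hx, hi, hU⟩
    exact ⟨x, hx, i, hi, rfl, fun ⟨p, hp, hle⟩ => hU p hp hle⟩

theorem mem_upper_k {P : RelSet M} {x i j l : M} : pair (pair x (pair i j)) l ∈ (upper P).k ↔
    x ∈ P.carrier ∧ i ∈ Pf P.carrier ∧ j ∈ Pf P.carrier ∧ l ∈ Pf P.carrier ∧
      ∀ p, FinMem p l ↔ FinMem p i ∨ FinMem p j := by
  constructor
  · rintro ⟨x', hx, i', hi, j', hj, l', hl, h, hU⟩
    obtain ⟨h₁, rfl⟩ := hM.pair_inj.1 h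
    obtain ⟨rfl, h₂⟩ := hM.pair_inj.1 h₁
    obtain ⟨rfl, rfl⟩ := hM.pair_inj.1 h₂
    exact ⟨hx, hi, hj, hl, hU⟩
  · rintro ⟨hx, hi, hj, hl, hU⟩
    exact ⟨x, hx, i, hi, j, hj, l, hl, rfl, hU⟩

theorem upper_U_mem {P : RelSet M} (hP : IsQuasiOrder S P) : (upper P).U ∈ S := by
  have := hP.nonempty
  have hA := hP.carrier_mem
  refine Set.mem_of_eq_of_mem ?_ (hM.comprehension (P := fun w => ∃ x i, w 0 = pair x i ∧
    (x ∈ P.carrier ∧ i ∈ Pf P.carrier ∧ ¬ ∃ p, FinMem p i ∧ pair x p ∈ P.rel))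
    (IsBdd.exists_pair hM (f := fun v => v 1) (P := fun x i _ => x ∈ P.carrier ∧
      i ∈ Pf P.carrier ∧ ¬ ∃ p, FinMem p i ∧ pair x p ∈ P.rel) (.var 1)
      ((IsBdd.mem hA (.var 1)).and ((IsBdd.mem_Pf hM hA (.var 0)).and
        (IsBdd.exists_finMem hM (f := fun v => v 0) (P := fun p v => pair (v 1) p ∈ P.rel) (.var 0)
          (IsBdd.mem hP.rel_mem (.pair (.var 2) (.var 0)))).not))) ![])
  ext z
  constructor
  · rintro ⟨x, hx, i, hi, h, hU⟩
    exact ⟨x, i, h, hx, hi, hU⟩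
  · rintro ⟨x, i, h, hx, hi, hU⟩
    exact ⟨x, hx, i, hi, h, hU⟩

/-- The equality `l = i ∪ j` is split into three inclusions, so that each quantifier ranges over the
elements of a finite set and is thus bounded. -/
theorem upper_k_mem {P : RelSet M} (hP : IsQuasiOrder S P) : (upper P).k ∈ S := by
  have := hP.nonempty
  have hA := hP.carrier_mem
  refine Set.mem_of_eq_of_mem ?_ (hM.comprehension (P := fun w => ∃ y l, w 0 = pair y l ∧
    ∃ x t, y = pair x t ∧ ∃ i j, t = pair i j ∧ (x ∈ P.carrier ∧ i ∈ Pf P.carrier ∧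
      j ∈ Pf P.carrier ∧ l ∈ Pf P.carrier ∧ (∀ p, FinMem p l → FinMem p i ∨ FinMem p j) ∧
      (∀ p, FinMem p i → FinMem p l) ∧ (∀ p, FinMem p j → FinMem p l)))
    (IsBdd.exists_pair hM (f := fun v => v 1) (P := fun y l _ =>
        ∃ x t, y = pair x t ∧ ∃ i j, t = pair i j ∧ (x ∈ P.carrier ∧ i ∈ Pf P.carrier ∧
          j ∈ Pf P.carrier ∧ l ∈ Pf P.carrier ∧ (∀ p, FinMem p l → FinMem p i ∨ FinMem p j) ∧
          (∀ p, FinMem p i → FinMem p l) ∧ (∀ p, FinMem p j → FinMem p l))) (.var 1)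
      (IsBdd.exists_pair hM (f := fun v => v 1) (P := fun x t v =>
          ∃ i j, t = pair i j ∧ (x ∈ P.carrier ∧ i ∈ Pf P.carrier ∧ j ∈ Pf P.carrier ∧
            v 0 ∈ Pf P.carrier ∧ (∀ p, FinMem p (v 0) → FinMem p i ∨ FinMem p j) ∧
            (∀ p, FinMem p i → FinMem p (v 0)) ∧ (∀ p, FinMem p j → FinMem p (v 0)))) (.var 1)
        (IsBdd.exists_pair hM (f := fun v => v 0) (P := fun i j v =>
            v 1 ∈ P.carrier ∧ i ∈ Pf P.carrier ∧ j ∈ Pf P.carrier ∧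
            v 2 ∈ Pf P.carrier ∧ (∀ p, FinMem p (v 2) → FinMem p i ∨ FinMem p j) ∧
            (∀ p, FinMem p i → FinMem p (v 2)) ∧ (∀ p, FinMem p j → FinMem p (v 2))) (.var 0)
          ((IsBdd.mem hA (.var 3)).and <| (IsBdd.mem_Pf hM hA (.var 1)).and <|
            (IsBdd.mem_Pf hM hA (.var 0)).and <| (IsBdd.mem_Pf hM hA (.var 4)).and <|
            (IsBdd.forall_finMem hM (f := fun v => v 4)
              (P := fun p v => FinMem p (v 1) ∨ FinMem p (v 0)) (.var 4)
              ((IsBdd.finMem hM (.var 0) (.var 2)).or (IsBdd.finMem hM (.var 0) (.var 1)))).and <|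
            (IsBdd.forall_finMem hM (f := fun v => v 1) (P := fun p v => FinMem p (v 4)) (.var 1)
              (IsBdd.finMem hM (.var 0) (.var 5))).and
            (IsBdd.forall_finMem hM (f := fun v => v 0) (P := fun p v => FinMem p (v 4)) (.var 0)
              (IsBdd.finMem hM (.var 0) (.var 5))))))) ![])
  ext z
  constructor
  · rintro ⟨x, hx, i, hi, j, hj, l, hl, h, hU⟩
    exact ⟨_, l, h, x, _, rfl, i, j, rfl, hx, hi, hj, hl, fun p => (hU p).1,
      fun p hp => (hU p).2 (.inl hp), fun p hp => (hU p).2 (.inr hp)⟩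
  · rintro ⟨_, l, h, x, _, rfl, i, j, rfl, hx, hi, hj, hl, h1, h2, h3⟩
    exact ⟨x, hx, i, hi, j, hj, l, hl, h, fun p => ⟨h1 p, fun hp => hp.elim (h2 p) (h3 p)⟩⟩

theorem isSpace_upper {P : RelSet M} (hP : IsQuasiOrder S P) : (upper P).IsSpace S := by
  have := hP.nonempty
  constructor
  · exact hP.carrier_mem
  · exact hM.Pf_mem hP.carrier_mem
  · exact hM.upper_U_mem hP
  · exact hM.upper_k_mem hP
  · rintro z ⟨x, hx, i, hi, h, -⟩
    exact ⟨x, hx, i, hi, h⟩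
  · constructor
    · rintro z ⟨x, hx, i, hi, j, hj, l, hl, h, -⟩
      exact ⟨_, hM.pair_mem_cprod.2 ⟨hx, hM.pair_mem_cprod.2 ⟨hi, hj⟩⟩, l, hl, h⟩
    · rintro _ ⟨x, hx, _, ⟨i, hi, j, hj, rfl⟩, rfl⟩
      obtain ⟨l, hl, hu⟩ := hM.exists_union hi hj
      refine ⟨l, hM.mem_upper_k.2 ⟨hx, hi, hj, hl, hu⟩, fun l' hl' => ?_⟩
      obtain ⟨-, -, -, hl', hu'⟩ := hM.mem_upper_k.1 hl'
      exact finCode_ext hl'.1 hl.1 fun p => (hu' p).trans (hu p).symm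
  · exact fun x hx => ⟨0, hM.zero_mem_Pf _, hM.inBasic_upper.2 ⟨hx, hM.zero_mem_Pf _,
      fun p hp => absurd hp (hM.not_finMem_zero p)⟩⟩
  · intro x hx i hi j hj hxi hxj l hl
    obtain ⟨-, -, -, hl, hu⟩ := hM.mem_upper_k.1 hl
    refine ⟨hM.inBasic_upper.2 ⟨hx, hl, fun p hp => ((hu p).1 hp).elim
      ((hM.inBasic_upper.1 hxi).2.2 p) ((hM.inBasic_upper.1 hxj).2.2 p)⟩, fun y hy hyl => ?_⟩
    have h := (hM.inBasic_upper.1 hyl).2.2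
    exact ⟨hM.inBasic_upper.2 ⟨hy, hi, fun p hp => h p ((hu p).2 (.inl hp))⟩,
      hM.inBasic_upper.2 ⟨hy, hj, fun p hp => h p ((hu p).2 (.inr hp))⟩⟩

/-! ### The spaces of arbitrary subsets -/

theorem isSpace_upperPFlat {Q : RelSet M} (hQ : IsQuasiOrder S Q) : (upperPFlat Q).IsSpace S := by
  have := hQ.nonempty
  constructor
  · exact hM.Pf_mem hQ.carrier_mem
  · exact fun X _ _ => ⟨0, hM.zero_mem_Pf _, fun q hq => absurd hq (hM.not_finMem_zero q)⟩
  · intro X _ _ i hi j hj hXi hXj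
    obtain ⟨l, hl, hu⟩ := hM.exists_union hi hj
    exact ⟨l, hl, fun q hq => ((hu q).1 hq).elim (hXi q) (hXj q), fun Y _ hY =>
      ⟨fun q hq => hY q ((hu q).2 (.inl hq)), fun q hq => hY q ((hu q).2 (.inr hq))⟩⟩
  · rintro X _ Y _ _ _ i _ h rfl
    exact h

theorem isSpace_upperPSharp {Q : RelSet M} (hQ : IsQuasiOrder S Q) :
    (upperPSharp Q).IsSpace S := by
  have := hQ.nonempty
  constructor
  · exact hM.Pf_mem hQ.carrier_mem
  · exact fun X _ _ => ⟨0, hM.zero_mem_Pf _, fun q hq => absurd hq (hM.not_finMem_zero q)⟩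
  · intro X _ _ i hi j hj hXi hXj
    obtain ⟨l, hl, hu⟩ := hM.exists_union hi hj
    exact ⟨l, hl, fun q hq => ((hu q).1 hq).elim (hXi q) (hXj q), fun Y _ hY =>
      ⟨fun q hq => hY q ((hu q).2 (.inl hq)), fun q hq => hY q ((hu q).2 (.inr hq))⟩⟩
  · rintro X _ Y _ _ _ i _ h rfl
    exact h

end ModelsRCA0

/-! ### Transfer of the Noetherian property -/

/-- The number `j < q` is an index that `R` assigns to a basic open set that is enumerated below `q`
into the complement of one of the first `n + 1` effectively closed sets coded by `g`. -/
def Enumerates (g R : Set M) (n q j : M) : Prop :=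
  j < q ∧ ∃ k, k < n + 1 ∧ ∃ m, m < q ∧ ∃ d, d < q ∧
    (pair (pair k m) d ∈ g ∧ ∃ i, FinMem i d ∧ pair i j ∈ R)

/-- The code of the sequence of effectively closed sets given by `Enumerates`. -/
def enumerationCode (g R : Set M) : Set M :=
  {z | ∃ t c, z = pair t c ∧ ∃ n q, t = pair n q ∧ (IsFinCode c ∧
    (∀ j, FinMem j c → Enumerates g R n q j) ∧ ∀ j, j < q → Enumerates g R n q j → FinMem j c)}

theorem IsBdd.enumerates [Nonempty S] (hM : ModelsRCA0 S) {g R : Set M} (hg : g ∈ S) (hR : R ∈ S)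
    {r : ℕ} {a b c : (Fin r → M) → M} (ha : IsTerm a) (hb : IsTerm b) (hc : IsTerm c) :
    IsBdd S (fun v => Enumerates g R (a v) (b v) (c v)) :=
  (IsBdd.lt hc hb).and <| IsBdd.bex (f := fun v => a v + 1) (P := fun k v =>
      ∃ m, m < b v ∧ ∃ d, d < b v ∧ (pair (pair k m) d ∈ g ∧ ∃ i, FinMem i d ∧ pair i (c v) ∈ R))
    (ha.add .one) <|
    IsBdd.bex (f := fun v => b fun i => v i.succ) (P := fun m v => ∃ d, d < b (fun i => v i.succ) ∧
      (pair (pair (v 0) m) d ∈ g ∧ ∃ i, FinMem i d ∧ pair i (c fun i => v i.succ) ∈ R)) hb.lift <|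
    IsBdd.bex (f := fun v => b fun i => v i.succ.succ) (P := fun d v =>
      (pair (pair (v 1) (v 0)) d ∈ g ∧ ∃ i, FinMem i d ∧ pair i (c fun i => v i.succ.succ) ∈ R))
      hb.lift.lift <|
    (IsBdd.mem hg (.pair (.pair (.var 2) (.var 1)) (.var 0))).and <|
    IsBdd.exists_finMem hM (f := fun v => v 0)
      (P := fun i v => pair i (c fun i => v i.succ.succ.succ) ∈ R) (.var 0)
      (IsBdd.mem hR (.pair (.var 0) hc.lift.lift.lift.lift))

namespace ModelsRCA0

variable (hM : ModelsRCA0 S)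
include hM

theorem enumerationCode_mem [Nonempty S] {g R : Set M} (hg : g ∈ S) (hR : R ∈ S) :
    enumerationCode g R ∈ S :=
  hM.comprehension (P := fun w => w 0 ∈ enumerationCode g R)
    (IsBdd.exists_pair hM (f := fun v => v 1) (P := fun t c _ => ∃ n q, t = pair n q ∧
        (IsFinCode c ∧ (∀ j, FinMem j c → Enumerates g R n q j) ∧
          ∀ j, j < q → Enumerates g R n q j → FinMem j c)) (.var 1)
      (IsBdd.exists_pair hM (f := fun v => v 1) (P := fun n q v =>
          (IsFinCode (v 0) ∧ (∀ j, FinMem j (v 0) → Enumerates g R n q j) ∧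
            ∀ j, j < q → Enumerates g R n q j → FinMem j (v 0))) (.var 1)
        ((IsBdd.isFinCode hM (.var 2)).and <|
          (IsBdd.forall_finMem hM (f := fun v => v 2)
            (P := fun j v => Enumerates g R (v 1) (v 0) j) (.var 2)
            (IsBdd.enumerates hM hg hR (.var 2) (.var 1) (.var 0))).and <|
          IsBdd.ball (f := fun v => v 0)
            (P := fun j v => Enumerates g R (v 1) (v 0) j → FinMem j (v 2)) (.var 0)
            ((IsBdd.enumerates hM hg hR (.var 2) (.var 1) (.var 0)).imp
              (IsBdd.finMem hM (.var 0) (.var 3)))))) ![]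

theorem pair_mem_enumerationCode {g R : Set M} {n q c : M} :
    pair (pair n q) c ∈ enumerationCode g R ↔
      IsFinCode c ∧ ∀ j, FinMem j c ↔ Enumerates g R n q j := by
  constructor
  · rintro ⟨t, c', h, n', q', rfl, hc, h1, h2⟩
    obtain ⟨h₁, rfl⟩ := hM.pair_inj.1 h
    obtain ⟨rfl, rfl⟩ := hM.pair_inj.1 h₁
    exact ⟨hc, fun j => ⟨h1 j, fun h => h2 j h.1 h⟩⟩
  · rintro ⟨hc, h⟩
    exact ⟨_, c, rfl, n, q, rfl, hc, fun j => (h j).1, fun j _ => (h j).2⟩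

theorem exists_pair_mem_enumerationCode [Nonempty S] {g R : Set M} (hg : g ∈ S) (hR : R ∈ S)
    (n q : M) : ∃ c, pair (pair n q) c ∈ enumerationCode g R := by
  have hE : {j | Enumerates g R n q j} ∈ S :=
    hM.comprehension (P := fun w => Enumerates g R (w 1) (w 2) (w 0))
      (IsBdd.enumerates hM hg hR (.var 2) (.var 3) (.var 1)) ![n, q]
  obtain ⟨c, hc, h⟩ := hM.exists_finCode hE (b := q) fun j hj => hj.1
  exact ⟨c, hM.pair_mem_enumerationCode.2 ⟨hc, h⟩⟩

theorem isFunction_enumerationCode [Nonempty S] {g R B : Set M} (hg : g ∈ S) (hR : R ∈ S)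
    (hRB : ∀ i j, pair i j ∈ R → j ∈ B) :
    IsFunction (enumerationCode g R) (cprod Set.univ Set.univ) (Pf B) := by
  constructor
  · rintro _ ⟨_, c, rfl, n, q, rfl, hc, h, -⟩
    refine hM.pair_mem_cprod.2 ⟨⟨n, trivial, q, trivial, rfl⟩, hc, fun j hj => ?_⟩
    obtain ⟨-, _, -, _, -, _, -, -, i, -, hij⟩ := h j hj
    exact hRB i j hij
  · rintro _ ⟨n, -, q, -, rfl⟩
    obtain ⟨c, hc⟩ := hM.exists_pair_mem_enumerationCode hg hR n q
    refine ⟨c, hc, fun c' hc' => ?_⟩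
    obtain ⟨hc, h⟩ := hM.pair_mem_enumerationCode.1 hc
    obtain ⟨hc', h'⟩ := hM.pair_mem_enumerationCode.1 hc'
    exact finCode_ext hc' hc fun j => (h' j).trans (h j).symm

/-- Membership in a closed set is `Π⁰₁`, but non-membership is `Σ⁰₁` and persists from each stage to
the next, so `Σ⁰₁` induction on `n` applies. -/
theorem not_inClosed_add [Nonempty S] {T : CSCSpace M} (hU : T.U ∈ S) {g : Set M} (hg : g ∈ S)
    (hdesc : ∀ n x, T.InClosed g (n + 1) x → T.InClosed g n x) {x k : M} (hx : x ∈ T.X)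
    (hk : ¬ T.InClosed g k x) (n : M) : ¬ T.InClosed g (k + n) x := by
  -- One number `y` bounds both `m` and `d`, leaving a single unbounded quantifier.
  have key (l : M) : ¬ T.InClosed g l x ↔ ∃ y, ∃ m, m < y ∧ ∃ d, d < y ∧
      (pair (pair l m) d ∈ g ∧ ∃ i, FinMem i d ∧ pair x i ∈ T.U) := by
    simp only [CSCSpace.InClosed, hx, true_and, CSCSpace.InBasic]
    push Not
    constructor
    · rintro ⟨m, d, hd, i, hi, h⟩
      exact ⟨m + d + 1, m, (hM.discrete _ _).2 (hM.le_add_right _ _), d,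
        (hM.discrete _ _).2 (hM.le_add_left _ _), hd, i, hi, h⟩
    · rintro ⟨y, m, -, d, -, hd, i, hi, h⟩
      exact ⟨m, d, hd, i, hi, h⟩
  have hbdd : IsBdd S fun v : Fin 4 → M => ∃ m, m < v 0 ∧ ∃ d, d < v 0 ∧
      (pair (pair (v 2 + v 1) m) d ∈ g ∧ ∃ i, FinMem i d ∧ pair (v 3) i ∈ T.U) :=
    IsBdd.bex (f := fun v : Fin 4 → M => v 0) (P := fun m v => ∃ d, d < v 0 ∧
        (pair (pair (v 2 + v 1) m) d ∈ g ∧ ∃ i, FinMem i d ∧ pair (v 3) i ∈ T.U)) (.var 0)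
      (IsBdd.bex (f := fun v : Fin 5 → M => v 1) (P := fun d v =>
          (pair (pair (v 3 + v 2) (v 0)) d ∈ g ∧ ∃ i, FinMem i d ∧ pair (v 4) i ∈ T.U)) (.var 1)
        ((IsBdd.mem hg (.pair (.pair (.add (.var 4) (.var 3)) (.var 1)) (.var 0))).and
          (IsBdd.exists_finMem hM (f := fun v : Fin 6 → M => v 0)
            (P := fun i v => pair (v 5) i ∈ T.U) (.var 0)
            (IsBdd.mem hU (.pair (.var 6) (.var 0))))))
  have hind := hM.sigma_ind (P := fun y w => ∃ m, m < y ∧ ∃ d, d < y ∧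
      (pair (pair (w 1 + w 0) m) d ∈ g ∧ ∃ i, FinMem i d ∧ pair (w 2) i ∈ T.U)) hbdd ![k, x]
  simp only [Matrix.cons_val] at hind
  simp only [← key] at hind
  refine hind ?_ (fun l hl => ?_) n
  · rwa [add_zero]
  · rw [← add_assoc]
    exact fun h => hl (hdesc _ _ h)

/-- The Noetherian property passes from `T'` to `T` if the points of `T` embed into `T'` in such a
way that every basic open set of `T` is the preimage of an effectively open set of `T'`. -/
theorem isNoetherian_of_embedding [Nonempty S] {T : CSCSpace M} {T' : SCSpace M} (hU : T.U ∈ S)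
    {R : Set M} (hR : R ∈ S) (hRI : ∀ i j, pair i j ∈ R → j ∈ T'.I) (e : M → Set M)
    (he : ∀ x ∈ T.X, e x ∈ S ∧ T'.IsPoint (e x))
    (hbasic : ∀ x ∈ T.X, ∀ i ∈ T.I,
      (T.InBasic x i ↔ ∃ j, pair i j ∈ R ∧ T'.InBasic (e x) j))
    (hT' : T'.IsNoetherian S) : T.IsNoetherian S := by
  intro g hg hgf hdesc
  have hiff (n x : M) (hx : x ∈ T.X) :
      T'.InClosed (enumerationCode g R) n (e x) ↔ T.InClosed g n x := by
    constructor
    · rintro ⟨-, h⟩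
      refine ⟨hx, fun m d hd i hi hxi => ?_⟩
      have hiI : i ∈ T.I := (hM.pair_mem_cprod.1 (hgf.1 hd)).2.2 i hi
      obtain ⟨j, hij, hj⟩ := (hbasic x hx i hiI).1 hxi
      -- This stage exceeds `j`, `m` and `d`, so the index `j` has been enumerated by then.
      obtain ⟨c, hc⟩ := hM.exists_pair_mem_enumerationCode hg hR n (j + m + d + 1)
      refine h _ c hc j (((hM.pair_mem_enumerationCode.1 hc).2 j).2 ⟨?_, n, lt_add_one n, m, ?_, d,
        ?_, hd, i, hi, hij⟩) hj
      · exact (hM.discrete _ _).2 ((hM.le_add_right _ _).trans (hM.le_add_right _ _))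
      · exact (hM.discrete _ _).2 ((hM.le_add_left _ _).trans (hM.le_add_right _ _))
      · exact (hM.discrete _ _).2 (hM.le_add_left _ _)
    · intro h
      refine ⟨(he x hx).2, fun q c hc j hj hxj => ?_⟩
      obtain ⟨-, k, hk, m, -, d, -, hd, i, hi, hij⟩ :=
        ((hM.pair_mem_enumerationCode.1 hc).2 j).1 hj
      have hiI : i ∈ T.I := (hM.pair_mem_cprod.1 (hgf.1 hd)).2.2 i hi
      obtain ⟨z, rfl⟩ := hM.exists_add ((hM.discrete _ _).1 hk)
      exact hM.not_inClosed_add hU hg hdesc hx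
        (fun h' => h'.2 m d hd i hi ((hbasic x hx i hiI).2 ⟨j, hij, hxj⟩)) z h
  -- Descent holds at every point `X`: an index enumerated because of some `k ≤ n` is also
  -- enumerated for `n + 1`.
  obtain ⟨N, hN⟩ := hT' (enumerationCode g R) (hM.enumerationCode_mem hg hR)
    (hM.isFunction_enumerationCode hg hR hRI) fun n X _ h => ⟨h.1, fun q c hc j hj => by
      obtain ⟨c', hc'⟩ := hM.exists_pair_mem_enumerationCode hg hR (n + 1) q
      obtain ⟨hjq, k, hk, hrest⟩ := ((hM.pair_mem_enumerationCode.1 hc).2 j).1 hj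
      exact h.2 q c' hc' j (((hM.pair_mem_enumerationCode.1 hc').2 j).2
        ⟨hjq, k, hk.trans (lt_add_one _), hrest⟩)⟩
  refine ⟨N, fun n hn x => ?_⟩
  by_cases hx : x ∈ T.X
  · rw [← hiff n x hx, ← hiff N x hx]
    exact hN n hn _ (he x hx).1
  · exact ⟨fun h => absurd h.1 hx, fun h => absurd h.1 hx⟩

end ModelsRCA0

/-! ### The two quasi-orders on finite subsets -/

namespace ModelsRCA0

variable (hM : ModelsRCA0 S) {Q : RelSet M}
include hM

theorem flat_le {a b : M} : (PfFlat Q).Le a b ↔ a ∈ Pf Q.carrier ∧ b ∈ Pf Q.carrier ∧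
    ∀ x, FinMem x a → ∃ y, FinMem y b ∧ Q.Le x y := by
  constructor
  · rintro ⟨a', ha, b', hb, h, hle⟩
    obtain ⟨rfl, rfl⟩ := hM.pair_inj.1 h
    exact ⟨ha, hb, hle⟩
  · rintro ⟨ha, hb, hle⟩
    exact ⟨a, ha, b, hb, rfl, hle⟩

theorem sharp_le {a b : M} : (PfSharp Q).Le a b ↔ a ∈ Pf Q.carrier ∧ b ∈ Pf Q.carrier ∧
    ∀ y, FinMem y b → ∃ x, FinMem x a ∧ Q.Le x y := by
  constructor
  · rintro ⟨a', ha, b', hb, h, hle⟩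
    obtain ⟨rfl, rfl⟩ := hM.pair_inj.1 h
    exact ⟨ha, hb, hle⟩
  · rintro ⟨ha, hb, hle⟩
    exact ⟨a, ha, b, hb, rfl, hle⟩

variable (hQ : IsQuasiOrder S Q)
include hQ

theorem flat_rel_mem : (PfFlat Q).rel ∈ S := by
  have := hQ.nonempty
  have hA := hQ.carrier_mem
  refine Set.mem_of_eq_of_mem ?_ (hM.comprehension (P := fun w => ∃ a b, w 0 = pair a b ∧
    (a ∈ Pf Q.carrier ∧ b ∈ Pf Q.carrier ∧
      ∀ x, FinMem x a → ∃ y, FinMem y b ∧ pair x y ∈ Q.rel))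
    (IsBdd.exists_pair hM (f := fun v => v 1) (P := fun a b _ => a ∈ Pf Q.carrier ∧
      b ∈ Pf Q.carrier ∧ ∀ x, FinMem x a → ∃ y, FinMem y b ∧ pair x y ∈ Q.rel) (.var 1)
      ((IsBdd.mem_Pf hM hA (.var 1)).and <| (IsBdd.mem_Pf hM hA (.var 0)).and <|
        IsBdd.forall_finMem hM (f := fun v => v 1)
          (P := fun x v => ∃ y, FinMem y (v 0) ∧ pair x y ∈ Q.rel) (.var 1) <|
        IsBdd.exists_finMem hM (f := fun v => v 1) (P := fun y v => pair (v 0) y ∈ Q.rel) (.var 1)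
          (IsBdd.mem hQ.rel_mem (.pair (.var 1) (.var 0))))) ![])
  ext z
  constructor
  · rintro ⟨a, ha, b, hb, h, hle⟩
    exact ⟨a, b, h, ha, hb, hle⟩
  · rintro ⟨a, b, h, ha, hb, hle⟩
    exact ⟨a, ha, b, hb, h, hle⟩

theorem sharp_rel_mem : (PfSharp Q).rel ∈ S := by
  have := hQ.nonempty
  have hA := hQ.carrier_mem
  refine Set.mem_of_eq_of_mem ?_ (hM.comprehension (P := fun w => ∃ a b, w 0 = pair a b ∧
    (a ∈ Pf Q.carrier ∧ b ∈ Pf Q.carrier ∧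
      ∀ y, FinMem y b → ∃ x, FinMem x a ∧ pair x y ∈ Q.rel))
    (IsBdd.exists_pair hM (f := fun v => v 1) (P := fun a b _ => a ∈ Pf Q.carrier ∧
      b ∈ Pf Q.carrier ∧ ∀ y, FinMem y b → ∃ x, FinMem x a ∧ pair x y ∈ Q.rel) (.var 1)
      ((IsBdd.mem_Pf hM hA (.var 1)).and <| (IsBdd.mem_Pf hM hA (.var 0)).and <|
        IsBdd.forall_finMem hM (f := fun v => v 0)
          (P := fun y v => ∃ x, FinMem x (v 1) ∧ pair x y ∈ Q.rel) (.var 0) <|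
        IsBdd.exists_finMem hM (f := fun v => v 2) (P := fun x v => pair x (v 0) ∈ Q.rel) (.var 2)
          (IsBdd.mem hQ.rel_mem (.pair (.var 0) (.var 1))))) ![])
  ext z
  constructor
  · rintro ⟨a, ha, b, hb, h, hle⟩
    exact ⟨a, b, h, ha, hb, hle⟩
  · rintro ⟨a, b, h, ha, hb, hle⟩
    exact ⟨a, ha, b, hb, h, hle⟩

theorem le_trans_of_isQuasiOrder {x y z : M} (hxy : Q.Le x y) (hyz : Q.Le y z) : Q.Le x z :=
  hQ.trans x (hQ.mem_of_le hM hxy).1 y (hQ.mem_of_le hM hxy).2 z (hQ.mem_of_le hM hyz).2 hxy hyz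

theorem isQuasiOrder_flat : IsQuasiOrder S (PfFlat Q) := by
  have := hQ.nonempty
  constructor
  · exact hM.Pf_mem hQ.carrier_mem
  · exact hM.flat_rel_mem hQ
  · rintro z ⟨a, ha, b, hb, h, -⟩
    exact ⟨a, ha, b, hb, h⟩
  · exact fun a ha => hM.flat_le.2 ⟨ha, ha, fun x hx => ⟨x, hx, hQ.refl x (ha.2 x hx)⟩⟩
  · intro a ha b _ c hc hab hbc
    refine hM.flat_le.2 ⟨ha, hc, fun x hx => ?_⟩
    obtain ⟨y, hy, hxy⟩ := (hM.flat_le.1 hab).2.2 x hx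
    obtain ⟨z, hz, hyz⟩ := (hM.flat_le.1 hbc).2.2 y hy
    exact ⟨z, hz, hM.le_trans_of_isQuasiOrder hQ hxy hyz⟩

theorem isQuasiOrder_sharp : IsQuasiOrder S (PfSharp Q) := by
  have := hQ.nonempty
  constructor
  · exact hM.Pf_mem hQ.carrier_mem
  · exact hM.sharp_rel_mem hQ
  · rintro z ⟨a, ha, b, hb, h, -⟩
    exact ⟨a, ha, b, hb, h⟩
  · exact fun a ha => hM.sharp_le.2 ⟨ha, ha, fun x hx => ⟨x, hx, hQ.refl x (ha.2 x hx)⟩⟩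
  · intro a ha b _ c hc hab hbc
    refine hM.sharp_le.2 ⟨ha, hc, fun z hz => ?_⟩
    obtain ⟨y, hy, hyz⟩ := (hM.sharp_le.1 hbc).2.2 z hz
    obtain ⟨x, hx, hxy⟩ := (hM.sharp_le.1 hab).2.2 y hy
    exact ⟨x, hx, hM.le_trans_of_isQuasiOrder hQ hxy hyz⟩

/-- The index `i` is assigned all `j` that lie, as points, in the basic open set `i`; these open
sets are upward closed. -/
theorem isNoetherian_flat (hN : (upperPFlat Q).IsNoetherian S) :
    (upper (PfFlat Q)).IsNoetherian S := by
  have := hQ.nonempty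
  have hU := hM.upper_U_mem (hM.isQuasiOrder_flat hQ)
  have hR : {z | ∃ i j, z = pair i j ∧ pair j i ∈ (upper (PfFlat Q)).U} ∈ S :=
    hM.comprehension (P := fun w => ∃ i j, w 0 = pair i j ∧ pair j i ∈ (upper (PfFlat Q)).U)
      (IsBdd.exists_pair hM (f := fun v => v 1)
        (P := fun i j _ => pair j i ∈ (upper (PfFlat Q)).U) (.var 1)
        (IsBdd.mem hU (.pair (.var 0) (.var 1)))) ![]
  have hRiff (i j : M) : pair i j ∈ {z | ∃ i j, z = pair i j ∧ pair j i ∈ (upper (PfFlat Q)).U} ↔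
      (upper (PfFlat Q)).InBasic j i := by
    constructor
    · rintro ⟨i', j', h, hU⟩
      obtain ⟨rfl, rfl⟩ := hM.pair_inj.1 h
      exact hU
    · exact fun h => ⟨i, j, rfl, h⟩
  refine hM.isNoetherian_of_embedding hU hR
    (fun i j h => (hM.inBasic_upper.1 ((hRiff i j).1 h)).1) (fun a => {i | FinMem i a})
    (fun a ha => ⟨hM.finMem_set_mem a, ha.2⟩) (fun a ha i hi => ?_) hN
  simp only [hRiff]
  constructor
  · exact fun h => ⟨a, h, fun q hq => ⟨q, hq, hQ.refl q (ha.2 q hq)⟩⟩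
  · rintro ⟨j, hj, hja⟩
    obtain ⟨hjQ, hi, hj⟩ := hM.inBasic_upper.1 hj
    exact hM.inBasic_upper.2 ⟨ha, hi, fun p hp hap => hj p hp
      (hM.le_trans_of_isQuasiOrder (hM.isQuasiOrder_flat hQ)
        (hM.flat_le.2 ⟨hjQ, ha, hja⟩) hap)⟩

/-- The index `i` is assigned all finite `j` meeting every `p ∈ i`: avoiding the upward closure of
`a`, such a `j` witnesses `a ≰♯ p` for all `p ∈ i` at once. -/
theorem isNoetherian_sharp (hN : (upperPSharp Q).IsNoetherian S) :
    (upper (PfSharp Q)).IsNoetherian S := by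
  have := hQ.nonempty
  have hU := hM.upper_U_mem (hM.isQuasiOrder_sharp hQ)
  set R : Set M := {z | ∃ i j, z = pair i j ∧
    (j ∈ Pf Q.carrier ∧ ∀ p, FinMem p i → ∃ b, FinMem b p ∧ FinMem b j)}
  have hR : R ∈ S :=
    hM.comprehension (P := fun w => w 0 ∈ R)
      (IsBdd.exists_pair hM (f := fun v => v 1)
        (P := fun i j _ => j ∈ Pf Q.carrier ∧ ∀ p, FinMem p i → ∃ b, FinMem b p ∧ FinMem b j)
        (.var 1) ((IsBdd.mem_Pf hM hQ.carrier_mem (.var 0)).and <|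
          IsBdd.forall_finMem hM (f := fun v => v 1)
            (P := fun p v => ∃ b, FinMem b p ∧ FinMem b (v 0)) (.var 1) <|
          IsBdd.exists_finMem hM (f := fun v => v 0) (P := fun b v => FinMem b (v 1)) (.var 0)
            (IsBdd.finMem hM (.var 0) (.var 2)))) ![]
  have hRiff (i j : M) : pair i j ∈ R ↔
      j ∈ Pf Q.carrier ∧ ∀ p, FinMem p i → ∃ b, FinMem b p ∧ FinMem b j := by
    constructor
    · rintro ⟨i', j', h, hU⟩
      obtain ⟨rfl, rfl⟩ := hM.pair_inj.1 h
      exact hU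
    · exact fun h => ⟨i, j, rfl, h⟩
  refine hM.isNoetherian_of_embedding hU hR (fun i j h => ((hRiff i j).1 h).1)
    (fun a => {i | FinMem i a}) (fun a ha => ⟨hM.finMem_set_mem a, ha.2⟩) (fun a ha i hi => ?_) hN
  simp only [hRiff]
  constructor
  · intro h
    obtain ⟨-, -, h⟩ := hM.inBasic_upper.1 h
    -- Choosing one `b` from each `p` is unnecessary: `j` collects every element of every `p ∈ i`
    -- outside the upward closure of `a`. All of these are below `i`, so a code exists.
    have hB : {b | ∃ p, FinMem p i ∧ (FinMem b p ∧ ¬ ∃ x, FinMem x a ∧ pair x b ∈ Q.rel)} ∈ S :=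
      hM.comprehension (P := fun w => ∃ p, FinMem p (w 1) ∧ (FinMem (w 0) p ∧
          ¬ ∃ x, FinMem x (w 2) ∧ pair x (w 0) ∈ Q.rel))
        (IsBdd.exists_finMem hM (f := fun v => v 2) (P := fun p v => FinMem (v 1) p ∧
            ¬ ∃ x, FinMem x (v 3) ∧ pair x (v 1) ∈ Q.rel) (.var 2)
          ((IsBdd.finMem hM (.var 2) (.var 0)).and
            (IsBdd.exists_finMem hM (f := fun v => v 4) (P := fun x v => pair x (v 2) ∈ Q.rel)
              (.var 4) (IsBdd.mem hQ.rel_mem (.pair (.var 0) (.var 3)))).not)) ![i, a]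
    obtain ⟨j, hj, hjB⟩ := hM.exists_finCode hB (b := i) fun b ⟨p, hp, hb, _⟩ =>
      (hM.lt_of_finMem hb).trans (hM.lt_of_finMem hp)
    refine ⟨j, ⟨⟨hj, fun b hb => ?_⟩, fun p hp => ?_⟩, fun q hq ⟨x, hx, hxq⟩ => ?_⟩
    · obtain ⟨p, hp, hb, -⟩ := (hjB b).1 hb
      exact (hi.2 p hp).2 b hb
    · by_contra! hcon
      refine h p hp (hM.sharp_le.2 ⟨ha, hi.2 p hp, fun b hb => ?_⟩)
      by_contra hb'
      exact hcon b hb ((hjB b).2 ⟨p, hp, hb, hb'⟩)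
    · obtain ⟨p, -, -, h'⟩ := (hjB q).1 hq
      exact h' ⟨x, hx, hxq⟩
  · rintro ⟨j, ⟨-, hj⟩, hja⟩
    refine hM.inBasic_upper.2 ⟨ha, hi, fun p hp hap => ?_⟩
    obtain ⟨b, hbp, hbj⟩ := hj p hp
    exact hja b hbj ((hM.sharp_le.1 hap).2.2 b hbp)

end ModelsRCA0

end Transfer

end SOA

theorem theorem3p13 {M : Type*} [CommSemiring M] [LinearOrder M] [IsStrictOrderedRing M]
    (S : Set (Set M)) (hM : SOA.ModelsRCA0 S) (Q : SOA.RelSet M) (hQ : SOA.IsQuasiOrder S Q) :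
    ((SOA.upperPFlat Q).IsSpace S ∧ SOA.IsQuasiOrder S (SOA.PfFlat Q) ∧
      (SOA.upper (SOA.PfFlat Q)).IsSpace S ∧
      ((SOA.upperPFlat Q).IsNoetherian S → (SOA.upper (SOA.PfFlat Q)).IsNoetherian S)) ∧
    ((SOA.upperPSharp Q).IsSpace S ∧ SOA.IsQuasiOrder S (SOA.PfSharp Q) ∧
      (SOA.upper (SOA.PfSharp Q)).IsSpace S ∧
      ((SOA.upperPSharp Q).IsNoetherian S → (SOA.upper (SOA.PfSharp Q)).IsNoetherian S)) :=
  ⟨⟨hM.isSpace_upperPFlat hQ, hM.isQuasiOrder_flat hQ, hM.isSpace_upper (hM.isQuasiOrder_flat hQ),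
      hM.isNoetherian_flat hQ⟩,
    ⟨hM.isSpace_upperPSharp hQ, hM.isQuasiOrder_sharp hQ,
      hM.isSpace_upper (hM.isQuasiOrder_sharp hQ), hM.isNoetherian_sharp hQ⟩⟩
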